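/- Let $\mathbb{P}$ be a (finite or infinite) partition and $\mathcal{A}$ the set of all events that are disjunctions of elements of $\mathbb{P}$ (its powerset), with impossible event $\emptyset$ and sure event $\Omega$. Let $P_0$ be a finitely additive probability on $\mathcal{A}$, $b>0$, $a\in\mathbb{R}$, $c=1-(a+b)$, and let $(\underline{P},\overline{P})$ be the Nearly-Linear model $$\underline{P}(E)=\min\{\max\{bP_0(E)+a,0\},1\},\qquad \overline{P}(E)=\max\{\min\{bP_0(E)+c,1\},0\}\qquad (E\in\mathcal{A}\setminus\{\emptyset,\Omega\}),$$ $\underline{P}(\emptyset)=\overline{P}(\emptyset)=0$, $\underline{P}(\Omega)=\overline{P}(\Omega)=1$. Suppose that $\underline{P}$ is coherent (in the sense of Williams). For $B\in\mathcal{A}\setminus\{\emptyset\}$ let $\underline{E}(\cdot|B)$ be the natural extension of $\underline{P}$, i.e. the restriction to the events $A|B$, $A\in\mathcal{A}$, of the pointwise smallest Williams-coherent lower probability on $\mathcal{A}\cup\{A|B:A\in\mathcal{A}\}$ that extends $\underline{P}$, and let $\overline{E}(A|B)=1-\underline{E}(\neg A|B)$. Let $\mathfrak{B}\subset\mathcal{A}\setminus\{\emptyset\}$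 be a partition of $\Omega$ and let $A\in\mathcal{A}$ be non-extreme (neither $\underline{P}(A)=\overline{P}(A)=0$ nor $\underline{P}(A)=\overline{P}(A)=1$) and logically independent of $\mathfrak{B}$ (no $B\in\mathfrak{B}$ implies $A$ or $\neg A$). For $B\in\mathfrak{B}$ consider the conditions (a) either $\underline{P}(A\wedge B)>0$, $\overline{P}(\neg A\wedge B)>0$ and $P_0(A\wedge\neg B)\ge P_0(\neg B)\,\underline{P}(A)$; or $\underline{P}(A\wedge B)=0$; (b) either $\underline{P}(\neg A\wedge B)>0$, $\overline{P}(A\wedge B)>0$ and $P_0(A\wedge\neg B)\le P_0(\neg B)\,\overline{P}(A)$; or $\underline{P}(\neg A\wedge B)=0$. 1) For every $B\in\mathfrak{B}$ with $\underline{P}(B)>0$, the inequalities $\underline{E}(A|B)\le\underline{P}(A)\le\overline{P}(A)\le\overline{E}(A|B)$ hold if and only if both (a) and (b) hold. 2) $\mathfrak{B}$ weakly dilates $A$, i.e. the inequalities in 1) hold for every $B\in\mathfrak{B}$, if and only if (a) and (b) both hold for every $B\in\mathfrak{B}$ with $\underline{P}(B)>0$. -/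

import Mathlib

namespace NearlyLinear

/-- A (precise) finitely additive probability on the powerset of `Ω`. The elements of `Ω` are the
atoms of the underlying (finite or infinite) partition; events are subsets of `Ω`. -/
structure FinAddProb (Ω : Type*) where
  prob : Set Ω → ℝ
  nonneg : ∀ A, 0 ≤ prob A
  univ : prob Set.univ = 1
  add : ∀ A B, Disjoint A B → prob (A ∪ B) = prob A + prob B

/-- The gain `I_B (I_A - x)` of a unit bet on the conditional event `A|B` at price `x`. -/
noncomputable def gain {Ω : Type*} (A B : Set Ω) (x : ℝ) (ω : Ω) : ℝ :=
  B.indicator (fun ω' => A.indicator 1 ω' - x) ω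

/-- Williams coherence of a conditional lower probability `Q` on a set `D` of conditional events,
a pair `(A, B)` standing for `A|B` and `Q A B` for its lower probability. The total gain `G` of a
finite bet takes finitely many values, so that `sup (G | S) ≥ 0`, for a non-empty `S`, says that
`G` is non-negative at some point of `S`. Here `S` is the union of the conditioning events of all
bets with a non-zero stake. -/
def WCoherent {Ω : Type*} (D : Set (Set Ω × Set Ω)) (Q : Set Ω → Set Ω → ℝ) : Prop :=
  ∀ (n : ℕ) (A₀ B₀ : Set Ω) (A B : Fin n → Set Ω) (s₀ : ℝ) (s : Fin n → ℝ),
    (A₀, B₀) ∈ D → (∀ i, (A i, B i) ∈ D) → 0 ≤ s₀ → (∀ i, 0 ≤ s i) →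
    {ω | (s₀ ≠ 0 ∧ ω ∈ B₀) ∨ ∃ i, s i ≠ 0 ∧ ω ∈ B i}.Nonempty →
    ∃ ω ∈ {ω | (s₀ ≠ 0 ∧ ω ∈ B₀) ∨ ∃ i, s i ≠ 0 ∧ ω ∈ B i},
      0 ≤ ∑ i, s i * gain (A i) (B i) (Q (A i) (B i)) ω - s₀ * gain A₀ B₀ (Q A₀ B₀) ω

/-- Coherence of an unconditional lower probability on all events (`A` is `A|Ω`). -/
def Coherent {Ω : Type*} (l : Set Ω → ℝ) : Prop :=
  WCoherent {E : Set Ω × Set Ω | E.2 = Set.univ} (fun A _ => l A)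

/-- `Q` is a coherent extension of the lower probability `l` from the unconditional events to all
events `A` and `A|B`, for the given `B`. -/
def IsCoherentExtension {Ω : Type*} (l : Set Ω → ℝ) (B : Set Ω) (Q : Set Ω → Set Ω → ℝ) : Prop :=
  WCoherent {E : Set Ω × Set Ω | E.2 = Set.univ ∨ E.2 = B} Q ∧ ∀ A, Q A Set.univ = l A

/-- The natural extension of `l` to `A|B`: the value at `A|B` of the least coherent extension,
that is, the infimum of the values of all coherent extensions. -/
noncomputable def lowerNatExt {Ω : Type*} (l : Set Ω → ℝ) (A B : Set Ω) : ℝ :=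
  sInf {x | ∃ Q, IsCoherentExtension l B Q ∧ Q A B = x}

/-- The natural extension of the conjugate upper probability to `A|B`. -/
noncomputable def upperNatExt {Ω : Type*} (l : Set Ω → ℝ) (A B : Set Ω) : ℝ :=
  1 - lowerNatExt l Aᶜ B

/-- The data of a Nearly-Linear model: a probability `P₀` and coefficients `a` and `b > 0`. -/
structure NLModel (Ω : Type*) where
  P₀ : FinAddProb Ω
  a : ℝ
  b : ℝ
  b_pos : 0 < b

namespace NLModel

variable {Ω : Type*} (M : NLModel Ω)

def c : ℝ := 1 - (M.a + M.b)

open Classical in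
noncomputable def lower (A : Set Ω) : ℝ :=
  if A = ∅ then 0 else if A = Set.univ then 1
  else min (max (M.b * M.P₀.prob A + M.a) 0) 1

open Classical in
noncomputable def upper (A : Set Ω) : ℝ :=
  if A = ∅ then 0 else if A = Set.univ then 1
  else max (min (M.b * M.P₀.prob A + M.c) 1) 0

/-- `lower A = upper A = 0` or `lower A = upper A = 1`. -/
def Extreme (A : Set Ω) : Prop :=
  (M.lower A = 0 ∧ M.upper A = 0) ∨ (M.lower A = 1 ∧ M.upper A = 1)

/-- The dilation inequalities for `A` at the conditioning event `B`. -/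
def DilatesAt (A B : Set Ω) : Prop :=
  lowerNatExt M.lower A B ≤ M.lower A ∧ M.lower A ≤ M.upper A ∧
    M.upper A ≤ upperNatExt M.lower A B

/-- The partition `𝔅` weakly dilates `A`. -/
def WeaklyDilates (𝔅 : Set (Set Ω)) (A : Set Ω) : Prop :=
  ∀ B ∈ 𝔅, M.DilatesAt A B

def ConditionA (A B : Set Ω) : Prop :=
  (0 < M.lower (A ∩ B) ∧ 0 < M.upper (Aᶜ ∩ B) ∧
    M.P₀.prob (A ∩ Bᶜ) ≥ M.P₀.prob Bᶜ * M.lower A) ∨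
  M.lower (A ∩ B) = 0

def ConditionB (A B : Set Ω) : Prop :=
  (0 < M.lower (Aᶜ ∩ B) ∧ 0 < M.upper (A ∩ B) ∧
    M.P₀.prob (A ∩ Bᶜ) ≤ M.P₀.prob Bᶜ * M.upper A) ∨
  M.lower (Aᶜ ∩ B) = 0

/-- The lower and upper probability of a Nearly-Linear model are conjugate. -/
theorem lower_eq (A : Set Ω) : M.lower A = 1 - M.upper Aᶜ := by
  have hne : (∅ : Set Ω) ≠ Set.univ := by
    intro h
    have h1 := M.P₀.add ∅ ∅ (by simp)
    have h2 := M.P₀.univ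
    rw [← h] at h2
    simp only [Set.union_self] at h1
    linarith
  have hp : M.P₀.prob A + M.P₀.prob Aᶜ = 1 := by
    rw [← M.P₀.add A Aᶜ disjoint_compl_right, Set.union_compl_self, M.P₀.univ]
  unfold lower upper c
  by_cases h0 : A = ∅
  · subst h0; simp [hne.symm]
  by_cases h1 : A = Set.univ
  · subst h1; simp [hne.symm]
  rw [if_neg h0, if_neg h1, if_neg (by simpa using h1), if_neg (by simpa using h0)]
  have e : M.b * M.P₀.prob Aᶜ + (1 - (M.a + M.b)) = 1 - (M.b * M.P₀.prob A + M.a) := by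
    rw [show M.P₀.prob Aᶜ = 1 - M.P₀.prob A by linarith]; ring
  rw [e]
  generalize M.b * M.P₀.prob A + M.a = t
  rcases le_total t 0 with h | h <;> rcases le_total t 1 with h' | h' <;>
    simp [min_def, max_def] <;> split_ifs <;> linarith

end NLModel

/-- `A` is logically independent of `𝔅`: no `B ∈ 𝔅` implies `A` or its negation. -/
def LogicallyIndependent {Ω : Type*} (A : Set Ω) (𝔅 : Set (Set Ω)) : Prop :=
  ∀ B ∈ 𝔅, ¬ B ⊆ A ∧ ¬ B ⊆ Aᶜ

end NearlyLinear

namespace NearlyLinear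

universe u

/-! ### Two-monotone lower probabilities -/

/-! A coherent Nearly-Linear lower probability is two-monotone (`isTwoMonotone_of_coherent`), and
for two-monotone `l` the conditional natural extension is explicit. If `l B > 0`, it is the quotient
`bayes l A B` (`IsTwoMonotone.lowerNatExt_eq_bayes`). Everything rests on the identity `I_B (I_A -
r) = (1 - r) I_{A ∩ B} + r I_{A ∪ Bᶜ} - r`. It turns a bet on `A|B` into bets on the nested events
`A ∩ B ⊆ A ∪ Bᶜ`, and a two-monotone `l` has a dominating probability that is exact at both. If `l B
= 0`, the vacuous extension is coherent. Logical independence then makes both natural extensions at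
most `0`, so dilation at `B` is automatic. For `l B > 0`, the comparison of the quotient with `lower
A` is decided by truncation in the boundary cases; otherwise all terms are affine in `P₀` and it
reduces to the sign of `P₀(A ∩ Bᶜ) - P₀(Bᶜ) lower A` (`lowerNatExt_le_iff`). Condition (b) is
condition (a) for `Aᶜ`. -/

structure IsTwoMonotone {Ω : Type*} (l : Set Ω → ℝ) : Prop where
  nonneg : ∀ A, 0 ≤ l A
  empty : l ∅ = 0
  univ : l Set.univ = 1
  supermodular : ∀ A B, l A + l B ≤ l (A ∪ B) + l (A ∩ B)

theorem IsTwoMonotone.mono {Ω : Type*} {l : Set Ω → ℝ} (hl : IsTwoMonotone l) {A B : Set Ω}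
    (h : A ⊆ B) : l A ≤ l B := by
  have h1 := hl.supermodular A (B \ A)
  rw [Set.union_sdiff_cancel h, Set.inter_sdiff_self, hl.empty] at h1
  linarith [hl.nonneg (B \ A)]

/-- An additive function that dominates a supermodular `v` on the subsets of `C`, with equality at
`C`, extends to one with the same property for a larger set. -/
theorem exists_additive_extension {T : Type*} [DecidableEq T] {v : Finset T → ℝ}
    (hv : ∀ S S', v S + v S' ≤ v (S ∪ S') + v (S ∩ S')) {C : Finset T} {p : T → ℝ}
    (hp : ∀ S ⊆ C, v S ≤ ∑ t ∈ S, p t) (hC : ∑ t ∈ C, p t = v C) {D : Finset T} (hCD : C ⊆ D) :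
    ∃ q : T → ℝ, (∀ t ∈ C, q t = p t) ∧ (∀ S ⊆ D, v S ≤ ∑ t ∈ S, q t) ∧
      ∑ t ∈ D, q t = v D := by
  suffices H : ∀ D : Finset T, ∃ q : T → ℝ, (∀ t ∈ C, q t = p t) ∧
      (∀ S ⊆ C ∪ D, v S ≤ ∑ t ∈ S, q t) ∧ ∑ t ∈ C ∪ D, q t = v (C ∪ D) by
    simpa [Finset.union_eq_right.2 hCD] using H D
  intro D
  induction D using Finset.induction_on with
  | empty => exact ⟨p, fun _ _ => rfl, by simpa using hp, by simpa using hC⟩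
  | insert x D _ ih =>
    obtain ⟨q, hq, hqS, hqD⟩ := ih
    rw [Finset.union_insert]
    by_cases hx : x ∈ C ∪ D
    · rw [Finset.insert_eq_self.2 hx]
      exact ⟨q, hq, hqS, hqD⟩
    set F := C ∪ D with hF
    have hagree : ∀ S : Finset T, x ∉ S →
        ∑ t ∈ S, Function.update q x (v (insert x F) - v F) t = ∑ t ∈ S, q t := by
      intro S hS
      refine Finset.sum_congr rfl fun t ht => ?_
      rw [Function.update_of_ne]
      rintro rfl
      exact hS ht
    -- Greedy choice: the new point receives its marginal value over `F`. Supermodularity at `S` and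
    -- `F` then preserves dominance.
    refine ⟨Function.update q x (v (insert x F) - v F), ?_, ?_, ?_⟩
    · intro t ht
      rw [Function.update_of_ne, hq t ht]
      rintro rfl
      exact hx (Finset.mem_union_left _ ht)
    · intro S hS
      by_cases hxS : x ∈ S
      · have hsub : S.erase x ⊆ F := by
          intro t ht
          have := hS (Finset.mem_of_mem_erase ht)
          exact (Finset.mem_insert.1 this).resolve_left (Finset.ne_of_mem_erase ht)
        rw [← Finset.add_sum_erase S _ hxS, Function.update_self,
          hagree _ (Finset.notMem_erase x S)]
        have h1 := hv S F
        have h2 : S ∪ F = insert x F := by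
          ext t
          simp only [Finset.mem_union, Finset.mem_insert]
          constructor
          · rintro (h | h)
            · exact Finset.mem_insert.1 (hS h)
            · exact Or.inr h
          · rintro (rfl | h)
            · exact Or.inl hxS
            · exact Or.inr h
        have h3 : S ∩ F = S.erase x := by
          ext t
          simp only [Finset.mem_inter, Finset.mem_erase]
          constructor
          · rintro ⟨h, h'⟩
            exact ⟨fun e => hx (e ▸ h'), h⟩
          · rintro ⟨h, h'⟩
            exact ⟨h', hsub (Finset.mem_erase.2 ⟨h, h'⟩)⟩
        rw [h2, h3] at h1
        linarith [hqS _ hsub]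
      · rw [hagree S hxS]
        exact hqS S fun t ht =>
          (Finset.mem_insert.1 (hS ht)).resolve_left (fun e => hxS (e ▸ ht))
    · rw [Finset.sum_insert hx, hagree F hx, Function.update_self, hqD]
      ring

/-- The expectation of `f` under the weights `p` at the points `σ t`. -/
def expect {Ω T : Type*} [Fintype T] (σ : T → Ω) (p : T → ℝ) (f : Ω → ℝ) : ℝ :=
  ∑ t, p t * f (σ t)

/-- A two-monotone `l` is dominated, on finitely many events, by a finitely supported probability
that agrees with `l` at two given nested events. -/
theorem IsTwoMonotone.exists_expect {Ω : Type u} {l : Set Ω → ℝ} (hl : IsTwoMonotone l)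
    {𝓔 : Set (Set Ω)} (h𝓔 : 𝓔.Finite) {X Y : Set Ω} (hX : X ∈ 𝓔) (hY : Y ∈ 𝓔) (hXY : X ⊆ Y) :
    ∃ (T : Type u) (_ : Fintype T) (σ : T → Ω) (p : T → ℝ), (∀ t, 0 ≤ p t) ∧ ∑ t, p t = 1 ∧
      (∀ E ∈ 𝓔, l E ≤ expect σ p (E.indicator 1)) ∧
      expect σ p (X.indicator 1) = l X ∧ expect σ p (Y.indicator 1) = l Y := by
  classical
  have : Finite 𝓔 := h𝓔
  -- The fibres of `φ` are the atoms generated by `𝓔`; `T` indexes them and `σ` picks a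
  -- representative of each.
  let φ : Ω → Set 𝓔 := fun ω => {E | ω ∈ E.1}
  let ψ : Ω → Set.range φ := fun ω => ⟨φ ω, ω, rfl⟩
  let T := Set.range φ
  let _ : Fintype T := Fintype.ofFinite T
  let σ : T → Ω := fun t => t.2.choose
  have hσ : ∀ t : T, φ (σ t) = t.1 := fun t => t.2.choose_spec
  have hσE : ∀ E ∈ 𝓔, ∀ ω, σ (ψ ω) ∈ E ↔ ω ∈ E := by
    intro E hE ω
    have h := hσ (ψ ω)
    have h' : (⟨E, hE⟩ : 𝓔) ∈ φ (σ (ψ ω)) ↔ (⟨E, hE⟩ : 𝓔) ∈ φ ω := by rw [h]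
    exact h'
  let v : Finset T → ℝ := fun S => l {ω | ψ ω ∈ S}
  let ev : Set Ω → Finset T := fun E => Finset.univ.filter (fun t => σ t ∈ E)
  have hev : ∀ E ∈ 𝓔, v (ev E) = l E := by
    intro E hE
    change l _ = l E
    congr 1
    ext ω
    simp only [ev, Set.mem_ofPred_eq, Finset.mem_filter, Finset.mem_univ, true_and]
    exact hσE E hE ω
  have hv : ∀ S S', v S + v S' ≤ v (S ∪ S') + v (S ∩ S') := by
    intro S S'
    have h := hl.supermodular {ω | ψ ω ∈ S} {ω | ψ ω ∈ S'}
    have h1 : {ω | ψ ω ∈ S} ∪ {ω | ψ ω ∈ S'} = {ω | ψ ω ∈ S ∪ S'} := by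
      ext ω; simp
    have h2 : {ω | ψ ω ∈ S} ∩ {ω | ψ ω ∈ S'} = {ω | ψ ω ∈ S ∩ S'} := by
      ext ω; simp
    rwa [h1, h2] at h
  have hv0 : v ∅ = 0 := by simp [v, hl.empty]
  -- The weights are built along the chain `∅ ⊆ ev X ⊆ ev Y ⊆ univ`, with equality at every stage.
  obtain ⟨p₁, -, h₁, e₁⟩ := exists_additive_extension (p := 0) hv (C := ∅)
    (by intro S hS; rw [Finset.subset_empty.1 hS, hv0]; simp) (by simp [hv0])
    (Finset.empty_subset (ev X))
  have hsub : ev X ⊆ ev Y := by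
    intro t ht
    simp only [ev, Finset.mem_filter, Finset.mem_univ, true_and] at ht ⊢
    exact hXY ht
  obtain ⟨p₂, a₂, h₂, e₂⟩ := exists_additive_extension hv h₁ e₁ hsub
  obtain ⟨p, a, h, e⟩ := exists_additive_extension hv h₂ e₂ (Finset.subset_univ _)
  have hexp : ∀ E, expect σ p (E.indicator 1) = ∑ t ∈ ev E, p t := by
    intro E
    simp only [expect, ev, Finset.sum_filter, Set.indicator_apply, Pi.one_apply, mul_ite, mul_one,
      mul_zero]
  refine ⟨T, inferInstance, σ, p, ?_, ?_, ?_, ?_, ?_⟩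
  · intro t
    have := h {t} (Finset.subset_univ _)
    rw [Finset.sum_singleton] at this
    exact (hl.nonneg _).trans this
  · rw [e]
    simp [v, hl.univ]
  · intro E hE
    rw [hexp, ← hev E hE]
    exact h _ (Finset.subset_univ _)
  · rw [hexp, ← hev X hX, ← e₁]
    exact Finset.sum_congr rfl fun t ht => by rw [a t (hsub ht), a₂ t ht]
  · rw [hexp, ← hev Y hY, ← e₂]
    exact Finset.sum_congr rfl fun t ht => a t ht

/-! ### Expectations of gains -/

section Expect

variable {Ω T : Type*} [Fintype T] {σ : T → Ω} {p : T → ℝ}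

theorem gain_eq (A B : Set Ω) (x : ℝ) (ω : Ω) :
    gain A B x ω = (A ∩ B).indicator 1 ω - x * B.indicator 1 ω := by
  by_cases hA : ω ∈ A <;> by_cases hB : ω ∈ B <;> simp [gain, hA, hB]

theorem expect_gain (A B : Set Ω) (x : ℝ) :
    expect σ p (gain A B x) =
      expect σ p ((A ∩ B).indicator 1) - x * expect σ p (B.indicator 1) := by
  simp only [expect, gain_eq, mul_sub, Finset.sum_sub_distrib, Finset.mul_sum]
  congr 1
  exact Finset.sum_congr rfl fun t _ => by ring

theorem expect_univ (hp : ∑ t, p t = 1) : expect σ p (Set.univ.indicator 1) = 1 := by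
  simpa [expect] using hp

theorem expect_union_compl (hp : ∑ t, p t = 1) (A B : Set Ω) :
    expect σ p ((A ∪ Bᶜ).indicator 1) =
      1 - expect σ p (B.indicator 1) + expect σ p ((A ∩ B).indicator 1) := by
  rw [← hp]
  simp only [expect, ← Finset.sum_sub_distrib, ← Finset.sum_add_distrib]
  refine Finset.sum_congr rfl fun t _ => ?_
  by_cases hA : σ t ∈ A <;> by_cases hB : σ t ∈ B <;> simp [hA, hB]

theorem expect_total_gain {n : ℕ} (A₀ B₀ : Set Ω) (A B : Fin n → Set Ω) (s₀ : ℝ) (s : Fin n → ℝ)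
    (x₀ : ℝ) (x : Fin n → ℝ) :
    expect σ p (fun ω => ∑ i, s i * gain (A i) (B i) (x i) ω - s₀ * gain A₀ B₀ x₀ ω) =
      ∑ i, s i * expect σ p (gain (A i) (B i) (x i)) - s₀ * expect σ p (gain A₀ B₀ x₀) := by
  simp only [expect, mul_sub, Finset.sum_sub_distrib, Finset.mul_sum]
  rw [Finset.sum_comm]
  congr 1
  · exact Finset.sum_congr rfl fun i _ => Finset.sum_congr rfl fun t _ => by ring
  · exact Finset.sum_congr rfl fun t _ => by ring

/-- If `G` were negative on all of `S`, the positive mass of `S` would make the expectation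
negative. -/
theorem exists_nonneg_of_expect_nonneg {G : Ω → ℝ} {S : Set Ω} (hp : ∀ t, 0 ≤ p t)
    (hG : 0 ≤ expect σ p G) (hGS : ∀ ω ∉ S, G ω = 0)
    (hS : 0 < expect σ p (S.indicator 1)) : ∃ ω ∈ S, 0 ≤ G ω := by
  by_contra! hneg
  obtain ⟨t, -, ht⟩ : ∃ t ∈ Finset.univ, 0 < p t * S.indicator (1 : Ω → ℝ) (σ t) := by
    by_contra! h
    exact absurd (Finset.sum_nonpos h) (not_le.2 hS)
  have htS : σ t ∈ S := by
    by_contra h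
    simp [h] at ht
  have htp : 0 < p t := by simpa [htS] using ht
  refine absurd hG (not_le.2 (Finset.sum_neg' (fun u _ => ?_) ⟨t, Finset.mem_univ t, ?_⟩))
  · by_cases hu : σ u ∈ S
    · exact mul_nonpos_of_nonneg_of_nonpos (hp u) (hneg _ hu).le
    · simp [hGS _ hu]
  · exact mul_neg_of_pos_of_neg htp (hneg _ htS)

theorem expect_mono (hp : ∀ t, 0 ≤ p t) {f g : Ω → ℝ} (h : ∀ ω, f ω ≤ g ω) :
    expect σ p f ≤ expect σ p g :=
  Finset.sum_le_sum fun t _ => mul_le_mul_of_nonneg_left (h _) (hp t)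

end Expect

/-! ### Natural extension of a two-monotone lower probability -/

/-- The union of the conditioning events of the bets with a non-zero stake. -/
def betSupport {Ω : Type*} {n : ℕ} (B₀ : Set Ω) (B : Fin n → Set Ω) (s₀ : ℝ) (s : Fin n → ℝ) :
    Set Ω :=
  {ω | (s₀ ≠ 0 ∧ ω ∈ B₀) ∨ ∃ i, s i ≠ 0 ∧ ω ∈ B i}

theorem total_gain_eq_zero {Ω : Type*} {n : ℕ} {A₀ B₀ : Set Ω} {A B : Fin n → Set Ω} {s₀ : ℝ}
    {s : Fin n → ℝ} (x₀ : ℝ) (x : Fin n → ℝ) {ω : Ω} (hω : ω ∉ betSupport B₀ B s₀ s) :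
    ∑ i, s i * gain (A i) (B i) (x i) ω - s₀ * gain A₀ B₀ x₀ ω = 0 := by
  simp only [betSupport, Set.mem_ofPred_eq, not_or, not_and, not_exists] at hω
  have h0 : s₀ * gain A₀ B₀ x₀ ω = 0 := by
    by_cases h : s₀ = 0
    · simp [h]
    · simp [gain, hω.1 h]
  rw [h0, sub_zero]
  refine Finset.sum_eq_zero fun i _ => ?_
  by_cases h : s i = 0
  · simp [h]
  · simp [gain, hω.2 i h]

theorem subset_betSupport {Ω : Type*} {n : ℕ} {B₀ C : Set Ω} {B : Fin n → Set Ω} {s₀ : ℝ}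
    {s : Fin n → ℝ} (h₀ : B₀ = Set.univ ∨ B₀ = C) (h : ∀ i, B i = Set.univ ∨ B i = C)
    (hne : (betSupport B₀ B s₀ s).Nonempty) : C ⊆ betSupport B₀ B s₀ s := by
  obtain ⟨η, hη⟩ := hne
  intro ω hω
  rcases hη with ⟨hs, -⟩ | ⟨i, hs, -⟩
  · refine Or.inl ⟨hs, ?_⟩
    rcases h₀ with e | e <;> simp [e, hω]
  · refine Or.inr ⟨i, hs, ?_⟩
    rcases h i with e | e <;> simp [e, hω]

/-- The generalised Bayes quotient. -/
noncomputable def bayes {Ω : Type*} (l : Set Ω → ℝ) (A B : Set Ω) : ℝ :=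
  l (A ∩ B) / (l (A ∩ B) + (1 - l (A ∪ Bᶜ)))

section TwoMonotone

variable {Ω : Type*} {l : Set Ω → ℝ}

theorem IsTwoMonotone.le_one (hl : IsTwoMonotone l) (A : Set Ω) : l A ≤ 1 :=
  hl.univ ▸ hl.mono (Set.subset_univ A)

/-- Supermodularity at `A ∪ Bᶜ` and `B` shows that the denominator is at least `l B`. -/
theorem IsTwoMonotone.bayes_denom_pos (hl : IsTwoMonotone l) (A : Set Ω) {B : Set Ω}
    (hB : 0 < l B) : 0 < l (A ∩ B) + (1 - l (A ∪ Bᶜ)) := by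
  have h := hl.supermodular (A ∪ Bᶜ) B
  have h1 : A ∪ Bᶜ ∪ B = Set.univ := by
    rw [Set.union_assoc, Set.compl_union_self, Set.union_univ]
  have h2 : (A ∪ Bᶜ) ∩ B = A ∩ B := by
    rw [Set.union_inter_distrib_right, Set.compl_inter_self, Set.union_empty]
  rw [h1, h2, hl.univ] at h
  linarith

theorem IsTwoMonotone.bayes_mem_Icc (hl : IsTwoMonotone l) (A : Set Ω) {B : Set Ω}
    (hB : 0 < l B) : bayes l A B ∈ Set.Icc (0 : ℝ) 1 := by
  have h := hl.bayes_denom_pos A hB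
  refine ⟨div_nonneg (hl.nonneg _) h.le, (div_le_one h).2 ?_⟩
  linarith [hl.le_one (A ∪ Bᶜ)]

/-- This is the statement that the bet on `A|B` at the quotient price is fair under any probability
agreeing with `l` at `A ∩ B` and `A ∪ Bᶜ`. -/
theorem IsTwoMonotone.one_sub_bayes_mul (hl : IsTwoMonotone l) (A : Set Ω) {B : Set Ω}
    (hB : 0 < l B) :
    (1 - bayes l A B) * l (A ∩ B) = bayes l A B * (1 - l (A ∪ Bᶜ)) := by
  have h := (hl.bayes_denom_pos A hB).ne'
  unfold bayes
  field_simp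
  ring

theorem bayes_univ (A : Set Ω) : bayes l A Set.univ = l A := by
  simp [bayes]

open Classical in
/-- The extension of `l` to the events `A|B` by the values `r A`. -/
noncomputable def extendBy (l r : Set Ω → ℝ) (A C : Set Ω) : ℝ :=
  if C = Set.univ then l A else r A

theorem extendBy_univ (r : Set Ω → ℝ) (A : Set Ω) : extendBy l r A Set.univ = l A := if_pos rfl

theorem extendBy_bayes (A B : Set Ω) : extendBy l (fun X => bayes l X B) A B = bayes l A B := by
  unfold extendBy
  split_ifs with h
  · rw [h, bayes_univ]
  · rfl

/-- The finitely many events that are relevant for a bet on `A₀` and the `A i`, given `B`. -/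
def relevantEvents {n : ℕ} (A₀ : Set Ω) (A : Fin n → Set Ω) (B : Set Ω) : Set (Set Ω) :=
  {B, A₀, A₀ ∩ B, A₀ ∪ Bᶜ} ∪ (Set.range A ∪
    (Set.range (fun i => A i ∩ B) ∪ Set.range (fun i => A i ∪ Bᶜ)))

theorem relevantEvents_finite {n : ℕ} (A₀ : Set Ω) (A : Fin n → Set Ω) (B : Set Ω) :
    (relevantEvents A₀ A B).Finite :=
  (Set.toFinite _).union ((Set.finite_range _).union
    ((Set.finite_range _).union (Set.finite_range _)))

/-- If `l B > 0`, the generalised Bayes quotients form a coherent extension. -/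
theorem IsTwoMonotone.isCoherentExtension_bayes (hl : IsTwoMonotone l) {B : Set Ω}
    (hB : 0 < l B) : IsCoherentExtension l B (extendBy l fun X => bayes l X B) := by
  refine ⟨?_, extendBy_univ _⟩
  intro n A₀ B₀ A C s₀ s h₀ h hs₀ hs hne
  change B₀ = Set.univ ∨ B₀ = B at h₀
  change ∀ i, C i = Set.univ ∨ C i = B at h
  -- `X` and `Y` are where the dominating probability must be exact for the bet against `A₀|B₀` to
  -- be fair. For `B₀ = univ` one event suffices.
  obtain ⟨X, Y, hX, hY, hXY, hXY₀⟩ : ∃ X Y, X ∈ relevantEvents A₀ A B ∧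
      Y ∈ relevantEvents A₀ A B ∧ X ⊆ Y ∧ ((B₀ = Set.univ ∧ X = A₀) ∨
        (B₀ = B ∧ X = A₀ ∩ B ∧ Y = A₀ ∪ Bᶜ)) := by
    rcases h₀ with e | e
    · exact ⟨A₀, A₀, by simp [relevantEvents], by simp [relevantEvents], subset_rfl,
        Or.inl ⟨e, rfl⟩⟩
    · exact ⟨A₀ ∩ B, A₀ ∪ Bᶜ, by simp [relevantEvents], by simp [relevantEvents],
        fun _ hx => Or.inl hx.1, Or.inr ⟨e, rfl, rfl⟩⟩
  obtain ⟨T, _, σ, p, hp, hp1, hdom, eX, eY⟩ :=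
    hl.exists_expect (relevantEvents_finite A₀ A B) hX hY hXY
  have hfav : ∀ i, 0 ≤ expect σ p
      (gain (A i) (C i) (extendBy l (fun X => bayes l X B) (A i) (C i))) := by
    intro i
    rcases h i with e | e
    · rw [e, extendBy_univ, expect_gain, expect_univ hp1, Set.inter_univ]
      linarith [hdom (A i) (by simp [relevantEvents])]
    · rw [e, extendBy_bayes, expect_gain]
      have d1 := hdom (A i ∩ B) (by simp [relevantEvents])
      have d2 := hdom (A i ∪ Bᶜ) (by simp [relevantEvents])
      rw [expect_union_compl hp1] at d2
      have hr := hl.bayes_mem_Icc (A i) hB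
      have he := hl.one_sub_bayes_mul (A i) hB
      have m1 := mul_le_mul_of_nonneg_left d1 (sub_nonneg.2 hr.2)
      have m2 := mul_le_mul_of_nonneg_left d2 hr.1
      linarith
  have hag : expect σ p (gain A₀ B₀ (extendBy l (fun X => bayes l X B) A₀ B₀)) = 0 := by
    rcases hXY₀ with ⟨e, rfl⟩ | ⟨e, rfl, rfl⟩
    · rw [e, extendBy_univ, expect_gain, expect_univ hp1, Set.inter_univ, eX]
      ring
    · rw [e, extendBy_bayes, expect_gain]
      rw [expect_union_compl hp1] at eY
      have he := hl.one_sub_bayes_mul A₀ hB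
      rw [← eX, ← eY] at he
      linarith
  refine exists_nonneg_of_expect_nonneg (σ := σ) hp ?_
    (fun ω hω => total_gain_eq_zero _ _ hω) ?_
  · rw [expect_total_gain, hag, mul_zero, sub_zero]
    exact Finset.sum_nonneg fun i _ => mul_nonneg (hs i) (hfav i)
  · refine lt_of_lt_of_le hB ((hdom B (by simp [relevantEvents])).trans
      (expect_mono hp fun ω => ?_))
    exact Set.indicator_le_indicator_of_subset (subset_betSupport h₀ h hne)
      (fun _ => zero_le_one) ω

open Classical in
/-- If `l B = 0`, the vacuous conditional lower probability is a coherent extension. -/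
theorem IsTwoMonotone.isCoherentExtension_vacuous (hl : IsTwoMonotone l) {B : Set Ω}
    (hB : l B = 0) (hBne : B.Nonempty) :
    IsCoherentExtension l B (extendBy l fun X => if B ⊆ X then 1 else 0) := by
  refine ⟨?_, extendBy_univ _⟩
  intro n A₀ B₀ A C s₀ s h₀ h hs₀ hs hne
  change B₀ = Set.univ ∨ B₀ = B at h₀
  change ∀ i, C i = Set.univ ∨ C i = B at h
  have hBu : B ≠ Set.univ := by
    rintro rfl
    linarith [hl.univ]
  have hval : ∀ X, extendBy l (fun X => if B ⊆ X then 1 else 0) X B =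
      if B ⊆ X then 1 else 0 := fun X => if_neg hBu
  have hfavB : ∀ X ω, 0 ≤ gain X B (extendBy l (fun X => if B ⊆ X then 1 else 0) X B) ω := by
    intro X ω
    rw [hval]
    by_cases hω : ω ∈ B
    · split_ifs with hX
      · simp [gain, hω, hX hω]
      · have h0 : 0 ≤ X.indicator (1 : Ω → ℝ) ω :=
          Set.indicator_nonneg (fun _ _ => zero_le_one) ω
        simpa [gain, hω] using h0
    · simp [gain, hω]
  -- If the support is all of `Ω`, a dominating probability gives it mass one. Otherwise no
  -- unconditional bet has a non-zero stake, and a point of `B` with zero opposing gain suffices.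
  by_cases hun : betSupport B₀ C s₀ s = Set.univ
  · change ∃ ω ∈ betSupport B₀ C s₀ s, _
    obtain ⟨X, hX, hX₀⟩ : ∃ X, X ∈ relevantEvents A₀ A B ∧ ((B₀ = Set.univ ∧ X = A₀) ∨
        (B₀ = B ∧ X = A₀ ∩ B)) := by
      rcases h₀ with e | e
      · exact ⟨A₀, by simp [relevantEvents], Or.inl ⟨e, rfl⟩⟩
      · exact ⟨A₀ ∩ B, by simp [relevantEvents], Or.inr ⟨e, rfl⟩⟩
    obtain ⟨T, _, σ, p, hp, hp1, hdom, eX, -⟩ :=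
      hl.exists_expect (relevantEvents_finite A₀ A B) hX hX subset_rfl
    refine exists_nonneg_of_expect_nonneg (σ := σ) hp ?_
      (fun ω hω => total_gain_eq_zero _ _ hω) (by rw [hun, expect_univ hp1]; exact one_pos)
    have hag : expect σ p
        (gain A₀ B₀ (extendBy l (fun X => if B ⊆ X then 1 else 0) A₀ B₀)) ≤ 0 := by
      rcases hX₀ with ⟨e, rfl⟩ | ⟨e, rfl⟩
      · rw [e, extendBy_univ, expect_gain, expect_univ hp1, Set.inter_univ, eX]
        linarith
      · have h0 : l (A₀ ∩ B) = 0 :=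
          le_antisymm (hB ▸ hl.mono Set.inter_subset_right) (hl.nonneg _)
        have hB0 : 0 ≤ expect σ p (B.indicator 1) :=
          (hl.nonneg _).trans (hdom B (by simp [relevantEvents]))
        rw [e, hval, expect_gain, eX, h0]
        split_ifs <;> linarith
    rw [expect_total_gain]
    have hsum : 0 ≤ ∑ i, s i * expect σ p (gain (A i) (C i)
        (extendBy l (fun X => if B ⊆ X then 1 else 0) (A i) (C i))) := by
      refine Finset.sum_nonneg fun i _ => mul_nonneg (hs i) ?_
      rcases h i with e | e
      · rw [e, extendBy_univ, expect_gain, expect_univ hp1, Set.inter_univ]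
        linarith [hdom (A i) (by simp [relevantEvents])]
      · rw [e]
        exact Finset.sum_nonneg fun t _ => mul_nonneg (hp t) (hfavB _ _)
    nlinarith [mul_nonneg hs₀ (neg_nonneg.2 hag)]
  · obtain ⟨ω, hω, hω₀⟩ : ∃ ω ∈ B,
        gain A₀ B (extendBy l (fun X => if B ⊆ X then 1 else 0) A₀ B) ω = 0 := by
      by_cases hA : B ⊆ A₀
      · obtain ⟨ω, hω⟩ := hBne
        exact ⟨ω, hω, by rw [hval]; simp [gain, hω, hA, hA hω]⟩
      · obtain ⟨ω, hω, hωA⟩ := Set.not_subset.1 hA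
        exact ⟨ω, hω, by rw [hval]; simp [gain, hω, hA, hωA]⟩
    refine ⟨ω, subset_betSupport h₀ h hne hω, ?_⟩
    have hz₀ : s₀ * gain A₀ B₀ (extendBy l (fun X => if B ⊆ X then 1 else 0) A₀ B₀) ω = 0 := by
      rcases h₀ with e | e
      · have : s₀ = 0 := by
          by_contra hs'
          exact hun (Set.eq_univ_of_forall fun η => Or.inl ⟨hs', e ▸ Set.mem_univ η⟩)
        rw [this, zero_mul]
      · rw [e, hω₀, mul_zero]
    rw [hz₀, sub_zero]
    refine Finset.sum_nonneg fun i _ => ?_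
    rcases h i with e | e
    · have : s i = 0 := by
        by_contra hs'
        exact hun (Set.eq_univ_of_forall fun η => Or.inr ⟨i, hs', e ▸ Set.mem_univ η⟩)
      rw [this, zero_mul]
    · rw [e]
      exact mul_nonneg (hs i) (hfavB _ _)

/-! ### Bounds on coherent extensions and values of the natural extension -/

theorem IsCoherentExtension.nonneg {B : Set Ω} {Q : Set Ω → Set Ω → ℝ}
    (hQ : IsCoherentExtension l B Q) (hB : B.Nonempty) (A : Set Ω) : 0 ≤ Q A B := by
  obtain ⟨ω, hω, h⟩ := hQ.1 0 A B Fin.elim0 Fin.elim0 1 Fin.elim0 (Or.inr rfl)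
    (fun i => i.elim0) zero_le_one (fun i => i.elim0) (by simpa using hB)
  have hωB : ω ∈ B := by simpa using hω
  have h0 : 0 ≤ A.indicator (1 : Ω → ℝ) ω := Set.indicator_nonneg (fun _ _ => zero_le_one) ω
  simp only [gain, Set.indicator_of_mem hωB, Finset.univ_eq_empty, Finset.sum_empty, one_mul] at h
  linarith

theorem IsCoherentExtension.le_one {B : Set Ω} {Q : Set Ω → Set Ω → ℝ}
    (hQ : IsCoherentExtension l B Q) (hB : B.Nonempty) (A : Set Ω) : Q A B ≤ 1 := by
  obtain ⟨ω, hω, h⟩ := hQ.1 1 A B (fun _ => A) (fun _ => B) 0 (fun _ => 1) (Or.inr rfl)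
    (fun _ => Or.inr rfl) le_rfl (fun _ => zero_le_one) (by simpa using hB)
  have hωB : ω ∈ B := by simpa using hω
  have h1 : A.indicator (1 : Ω → ℝ) ω ≤ 1 := Set.indicator_le_self' (fun _ _ => zero_le_one) ω
  simp only [gain, Set.indicator_of_mem hωB, Finset.univ_unique, Finset.sum_singleton, one_mul,
    zero_mul, sub_zero] at h
  linarith

theorem bddBelow_extensions {B : Set Ω} (hB : B.Nonempty) (A : Set Ω) :
    BddBelow {x | ∃ Q, IsCoherentExtension l B Q ∧ Q A B = x} :=
  ⟨0, by rintro x ⟨Q, hQ, rfl⟩; exact hQ.nonneg hB A⟩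

/-- Every coherent extension dominates the generalised Bayes quotient. -/
theorem IsCoherentExtension.bayes_le (hl : IsTwoMonotone l) {B : Set Ω} (hB : 0 < l B)
    (hBne : B.Nonempty) {Q : Set Ω → Set Ω → ℝ} (hQ : IsCoherentExtension l B Q) (A : Set Ω) :
    bayes l A B ≤ Q A B := by
  have h0 := hQ.nonneg hBne A
  have h1 := hQ.le_one hBne A
  -- With stakes `1 - Q A B` and `Q A B` the total gain is constant, by the identity for `I_B (I_A -
  -- r)` at `r = Q A B`; its non-negativity is the claim.
  obtain ⟨ω, -, h⟩ := hQ.1 2 A B ![A ∩ B, A ∪ Bᶜ] ![Set.univ, Set.univ] 1 ![1 - Q A B, Q A B]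
    (Or.inr rfl) (by intro i; fin_cases i <;> exact Or.inl rfl) zero_le_one
    (by intro i; fin_cases i <;> simp [h0, h1]) (by
      obtain ⟨η, hη⟩ := hBne
      exact ⟨η, Or.inl ⟨one_ne_zero, hη⟩⟩)
  simp only [Fin.sum_univ_two, Matrix.cons_val_zero, Matrix.cons_val_one, one_mul, hQ.2] at h
  rw [bayes, div_le_iff₀ (hl.bayes_denom_pos A hB)]
  by_cases hA : ω ∈ A <;> by_cases hωB : ω ∈ B <;> simp [gain, hA, hωB] at h <;> linarith

theorem IsTwoMonotone.lowerNatExt_eq_bayes (hl : IsTwoMonotone l) {B : Set Ω} (hB : 0 < l B)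
    (A : Set Ω) : lowerNatExt l A B = bayes l A B := by
  have hBne : B.Nonempty := by
    rw [Set.nonempty_iff_ne_empty]
    rintro rfl
    linarith [hl.empty]
  have hQ := hl.isCoherentExtension_bayes hB
  apply le_antisymm
  · exact csInf_le (bddBelow_extensions hBne A) ⟨_, hQ, extendBy_bayes A B⟩
  · refine le_csInf ⟨_, _, hQ, rfl⟩ ?_
    rintro x ⟨Q, hQ, rfl⟩
    exact hQ.bayes_le hl hB hBne A

theorem IsTwoMonotone.lowerNatExt_le_zero (hl : IsTwoMonotone l) {A B : Set Ω} (hB : l B = 0)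
    (hBA : ¬ B ⊆ A) : lowerNatExt l A B ≤ 0 := by
  classical
  have hBne : B.Nonempty := (Set.nonempty_of_not_subset hBA).mono Set.sdiff_subset
  have hBu : B ≠ Set.univ := by
    rintro rfl
    linarith [hl.univ]
  exact csInf_le (bddBelow_extensions hBne A)
    ⟨_, hl.isCoherentExtension_vacuous hB hBne, by simp [extendBy, hBu, hBA]⟩

end TwoMonotone

/-! ### Coherent lower probabilities -/

section Coherent

variable {Ω : Type*} {l : Set Ω → ℝ}

theorem Coherent.add_le_add_one (hl : Coherent l) [Nonempty Ω] (A B : Set Ω) :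
    l A + l B ≤ 1 + l (A ∩ B) := by
  obtain ⟨ω, -, h⟩ := hl 2 (A ∩ B) Set.univ ![A, B] ![Set.univ, Set.univ] 1 ![1, 1] rfl
    (by intro i; fin_cases i <;> rfl) zero_le_one (by intro i; fin_cases i <;> simp)
    ⟨Classical.arbitrary Ω, Or.inl ⟨one_ne_zero, Set.mem_univ _⟩⟩
  simp only [Fin.sum_univ_two, Matrix.cons_val_zero, Matrix.cons_val_one, one_mul] at h
  by_cases hA : ω ∈ A <;> by_cases hB : ω ∈ B <;> simp [gain, hA, hB] at h <;> linarith

theorem Coherent.superadditive (hl : Coherent l) [Nonempty Ω] {A B : Set Ω} (hAB : Disjoint A B) :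
    l A + l B ≤ l (A ∪ B) := by
  obtain ⟨ω, -, h⟩ := hl 2 (A ∪ B) Set.univ ![A, B] ![Set.univ, Set.univ] 1 ![1, 1] rfl
    (by intro i; fin_cases i <;> rfl) zero_le_one (by intro i; fin_cases i <;> simp)
    ⟨Classical.arbitrary Ω, Or.inl ⟨one_ne_zero, Set.mem_univ _⟩⟩
  simp only [Fin.sum_univ_two, Matrix.cons_val_zero, Matrix.cons_val_one, one_mul] at h
  by_cases hA : ω ∈ A
  · have hB : ω ∉ B := fun hB => Set.disjoint_left.1 hAB hA hB
    simp [gain, hA, hB] at h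
    linarith
  · by_cases hB : ω ∈ B <;> simp [gain, hA, hB] at h <;> linarith

end Coherent

/-! ### Nearly-Linear models -/

theorem FinAddProb.empty {Ω : Type*} (P : FinAddProb Ω) : P.prob ∅ = 0 := by
  have h := P.add ∅ ∅ (by simp)
  rw [Set.union_self] at h
  linarith

theorem FinAddProb.nonempty {Ω : Type*} (P : FinAddProb Ω) : Nonempty Ω := by
  by_contra h
  have := P.univ
  rw [Set.univ_eq_empty_iff.2 (not_nonempty_iff.1 h), P.empty] at this
  exact zero_ne_one this

theorem FinAddProb.inter_add_diff {Ω : Type*} (P : FinAddProb Ω) (A B : Set Ω) :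
    P.prob (A ∩ B) + P.prob (A ∩ Bᶜ) = P.prob A := by
  rw [← P.add, Set.inter_union_compl]
  exact disjoint_compl_right.mono Set.inter_subset_right Set.inter_subset_right

theorem FinAddProb.add_compl {Ω : Type*} (P : FinAddProb Ω) (A : Set Ω) :
    P.prob A + P.prob Aᶜ = 1 := by
  rw [← P.add A Aᶜ disjoint_compl_right, Set.union_compl_self, P.univ]

theorem FinAddProb.union_add_inter {Ω : Type*} (P : FinAddProb Ω) (A B : Set Ω) :
    P.prob (A ∪ B) + P.prob (A ∩ B) = P.prob A + P.prob B := by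
  have h1 := P.inter_add_diff (A ∪ B) B
  have h2 := P.inter_add_diff A B
  rw [Set.union_inter_cancel_right, show (A ∪ B) ∩ Bᶜ = A ∩ Bᶜ by
    rw [Set.union_inter_distrib_right, Set.inter_compl_self, Set.union_empty]] at h1
  linarith

theorem FinAddProb.mono {Ω : Type*} (P : FinAddProb Ω) {A B : Set Ω} (h : A ⊆ B) :
    P.prob A ≤ P.prob B := by
  have := P.inter_add_diff B A
  rw [Set.inter_eq_right.2 h] at this
  linarith [P.nonneg (B ∩ Aᶜ)]

namespace NLModel

variable {Ω : Type*} (M : NLModel Ω)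

theorem lower_empty : M.lower ∅ = 0 := if_pos rfl

theorem lower_univ : M.lower Set.univ = 1 := by
  have := M.P₀.nonempty
  rw [lower, if_neg Set.univ_nonempty.ne_empty, if_pos rfl]

theorem lower_of_ne {A : Set Ω} (h0 : A ≠ ∅) (h1 : A ≠ Set.univ) :
    M.lower A = min (max (M.b * M.P₀.prob A + M.a) 0) 1 := by
  rw [lower, if_neg h0, if_neg h1]

theorem lower_nonneg (A : Set Ω) : 0 ≤ M.lower A := by
  unfold lower
  split_ifs
  · exact le_rfl
  · exact zero_le_one
  · exact le_min (le_max_right _ _) zero_le_one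

theorem lower_le_one (A : Set Ω) : M.lower A ≤ 1 := by
  unfold lower
  split_ifs
  · exact zero_le_one
  · exact le_rfl
  · exact min_le_right _ _

theorem lower_compl (A : Set Ω) : M.lower Aᶜ = 1 - M.upper A := by
  rw [M.lower_eq, compl_compl]

theorem lower_of_lt_one {A : Set Ω} (h0 : A ≠ ∅) (h : M.lower A < 1) :
    M.lower A = max (M.b * M.P₀.prob A + M.a) 0 := by
  have h1 : A ≠ Set.univ := by
    rintro rfl
    exact h.ne M.lower_univ
  rw [M.lower_of_ne h0 h1] at h ⊢
  exact min_eq_left ((min_lt_iff.1 h).resolve_right (lt_irrefl _)).le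

theorem lower_of_mem_Ioo {A : Set Ω} (h : 0 < M.lower A) (h' : M.lower A < 1) :
    M.lower A = M.b * M.P₀.prob A + M.a := by
  have h0 : A ≠ ∅ := by
    rintro rfl
    exact h.ne' M.lower_empty
  rw [M.lower_of_lt_one h0 h'] at h ⊢
  exact max_eq_left ((lt_max_iff.1 h).resolve_right (lt_irrefl _)).le

theorem le_lower {A : Set Ω} (h0 : A ≠ ∅) (h : M.lower A < 1) :
    M.b * M.P₀.prob A + M.a ≤ M.lower A := by
  rw [M.lower_of_lt_one h0 h]
  exact le_max_left _ _

theorem lower_mono {A B : Set Ω} (h : A ⊆ B) : M.lower A ≤ M.lower B := by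
  by_cases hA : A = ∅
  · rw [hA, M.lower_empty]
    exact M.lower_nonneg B
  by_cases hB : B = Set.univ
  · rw [hB, M.lower_univ]
    exact M.lower_le_one A
  rw [M.lower_of_ne hA fun e => hB (Set.univ_subset_iff.1 (e ▸ h)),
    M.lower_of_ne (fun e => hA (Set.subset_empty_iff.1 (e ▸ h))) hB]
  have := mul_le_mul_of_nonneg_left (M.P₀.mono h) M.b_pos.le
  gcongr

variable {M}

/-- A coherent Nearly-Linear lower probability is two-monotone. -/
theorem isTwoMonotone_of_coherent (hM : Coherent M.lower) : IsTwoMonotone M.lower := by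
  have := M.P₀.nonempty
  refine ⟨M.lower_nonneg, M.lower_empty, M.lower_univ, fun A B => ?_⟩
  rcases (M.lower_le_one (A ∪ B)).eq_or_lt with h1 | h1
  · rw [h1]
    exact hM.add_le_add_one A B
  have hA1 : M.lower A < 1 := (M.lower_mono Set.subset_union_left).trans_lt h1
  have hB1 : M.lower B < 1 := (M.lower_mono Set.subset_union_right).trans_lt h1
  rcases (M.lower_nonneg A).eq_or_lt with hA | hA
  · linarith [M.lower_mono (Set.subset_union_right : B ⊆ A ∪ B), M.lower_nonneg (A ∩ B)]
  rcases (M.lower_nonneg B).eq_or_lt with hB | hB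
  · linarith [M.lower_mono (Set.subset_union_left : A ⊆ A ∪ B), M.lower_nonneg (A ∩ B)]
  by_cases hAB : A ⊆ B
  · rw [Set.union_eq_right.2 hAB, Set.inter_eq_left.2 hAB, add_comm]
  by_cases hBA : B ⊆ A
  · rw [Set.union_eq_left.2 hBA, Set.inter_eq_right.2 hBA]
  have hD : (A \ B).Nonempty := Set.nonempty_of_not_subset hAB
  have hD' : (B \ A).Nonempty := Set.nonempty_of_not_subset hBA
  have eA := M.lower_of_mem_Ioo hA hA1
  have eB := M.lower_of_mem_Ioo hB hB1
  have hU : M.b * M.P₀.prob (A ∪ B) + M.a ≤ M.lower (A ∪ B) :=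
    M.le_lower (hD.mono fun _ h => Or.inl h.1).ne_empty h1
  have hmod : M.b * M.P₀.prob (A ∪ B) + M.b * M.P₀.prob (A ∩ B) =
      M.b * M.P₀.prob A + M.b * M.P₀.prob B := by
    rw [← mul_add, M.P₀.union_add_inter, mul_add]
  -- The affine formula is modular. For `a ≤ 0` it bounds `lower` from below even at `∅`, where it
  -- gives `a`.
  rcases le_or_gt M.a 0 with ha | ha
  · by_cases hI : A ∩ B = ∅
    · rw [hI, M.P₀.empty] at hmod
      linarith [M.lower_nonneg (A ∩ B)]
    · have := M.le_lower hI ((M.lower_mono (Set.inter_subset_left)).trans_lt hA1)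
      linarith
  -- For `a > 0`, superadditivity on `A \ B` and `B \ A` counts `a` twice on the left and once on
  -- the right.
  · exfalso
    have hdisj : Disjoint (A \ B) (B \ A) := disjoint_sdiff_sdiff
    have hsup := hM.superadditive hdisj
    have hlt : M.lower (A \ B ∪ B \ A) < 1 := by
      refine (M.lower_mono ?_).trans_lt h1
      exact Set.union_subset_union Set.sdiff_subset Set.sdiff_subset
    have hp1 := mul_nonneg M.b_pos.le (M.P₀.nonneg (A \ B))
    have hp2 := mul_nonneg M.b_pos.le (M.P₀.nonneg (B \ A))
    have e1 := M.le_lower hD.ne_empty (by linarith [M.lower_nonneg (B \ A)])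
    have e2 := M.le_lower hD'.ne_empty (by linarith [M.lower_nonneg (A \ B)])
    have e3 := M.lower_of_mem_Ioo (A := A \ B ∪ B \ A) (by linarith) hlt
    rw [M.P₀.add _ _ hdisj] at e3
    linarith

/-! ### Conjugacy and the dilation criterion -/

theorem upper_eq (A : Set Ω) : M.upper A = 1 - M.lower Aᶜ := by
  rw [M.lower_compl]
  ring

theorem lower_le_upper (hM : Coherent M.lower) (A : Set Ω) : M.lower A ≤ M.upper A := by
  have := M.P₀.nonempty
  have h := hM.superadditive (disjoint_compl_right (a := A))
  rw [Set.union_compl_self, M.lower_univ, M.lower_compl] at h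
  linarith

theorem Extreme.of_compl {A : Set Ω} (h : M.Extreme Aᶜ) : M.Extreme A := by
  rw [Extreme, M.lower_compl, M.upper_eq (A := Aᶜ), compl_compl] at h
  rcases h with h | h
  · exact Or.inr ⟨by linarith [h.2], by linarith [h.1]⟩
  · exact Or.inl ⟨by linarith [h.2], by linarith [h.1]⟩

theorem lower_lt_one (hM : Coherent M.lower) {A : Set Ω} (h : ¬ M.Extreme A) : M.lower A < 1 := by
  refine (M.lower_le_one A).lt_of_ne fun h1 => h (Or.inr ⟨h1, le_antisymm ?_ ?_⟩)
  · rw [M.upper_eq]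
    linarith [M.lower_nonneg Aᶜ]
  · rw [← h1]
    exact M.lower_le_upper hM A

theorem upper_compl_inter (A B : Set Ω) : M.upper (Aᶜ ∩ B) = 1 - M.lower (A ∪ Bᶜ) := by
  rw [M.upper_eq, Set.compl_inter, compl_compl]

theorem conditionB_iff (A B : Set Ω) : M.ConditionB A B ↔ M.ConditionA Aᶜ B := by
  have h1 := M.P₀.inter_add_diff Bᶜ A
  rw [Set.inter_comm, Set.inter_comm Bᶜ] at h1
  have h2 : M.P₀.prob (A ∩ Bᶜ) ≤ M.P₀.prob Bᶜ * M.upper A ↔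
      M.P₀.prob (Aᶜ ∩ Bᶜ) ≥ M.P₀.prob Bᶜ * M.lower Aᶜ := by
    rw [M.lower_compl, mul_sub, mul_one]
    constructor <;> intro h <;> linarith
  rw [ConditionB, ConditionA, compl_compl, h2]

theorem lowerNatExt_le_iff (hM : Coherent M.lower) {A B : Set Ω} (hA : ¬ M.Extreme A)
    (hB : 0 < M.lower B) :
    lowerNatExt M.lower A B ≤ M.lower A ↔ M.ConditionA A B := by
  have h2 := isTwoMonotone_of_coherent hM
  have hA1 := M.lower_lt_one hM hA
  have hden := h2.bayes_denom_pos A hB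
  rw [h2.lowerNatExt_eq_bayes hB, ConditionA, bayes, div_le_iff₀ hden, upper_compl_inter]
  rcases (M.lower_nonneg (A ∩ B)).eq_or_lt with h0 | h0
  · rw [← h0] at hden ⊢
    exact iff_of_true (mul_nonneg (M.lower_nonneg A) hden.le) (Or.inr rfl)
  have hAB : M.lower (A ∩ B) ≤ M.lower A := M.lower_mono Set.inter_subset_left
  have hU : M.lower A ≤ M.lower (A ∪ Bᶜ) := M.lower_mono Set.subset_union_left
  -- If `lower (A ∪ Bᶜ) = 1`, the quotient is `1`, exceeding `lower A`, and `upper (Aᶜ ∩ B) = 0`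
  -- rules out the first alternative.
  rcases (M.lower_le_one (A ∪ Bᶜ)).eq_or_lt with h1 | h1
  · rw [h1]
    refine iff_of_false ?_ ?_
    · rw [sub_self, add_zero, not_le]
      exact mul_lt_of_lt_one_left h0 hA1
    · rintro (h | h)
      · exact (sub_self (1 : ℝ) ▸ h.2.1).false
      · exact h0.ne' h
  have e1 := M.lower_of_mem_Ioo h0 (hAB.trans_lt hA1)
  have e2 := M.lower_of_mem_Ioo (h0.trans_le hAB) hA1
  have e3 := M.lower_of_mem_Ioo (h0.trans_le (hAB.trans hU)) h1
  have p1 := M.P₀.inter_add_diff A B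
  have p2 := M.P₀.union_add_inter A Bᶜ
  -- No truncation is active here, so the denominator collapses to `1 - b P₀(Bᶜ)`.
  have key : M.lower A * (M.lower (A ∩ B) + (1 - M.lower (A ∪ Bᶜ))) - M.lower (A ∩ B) =
      M.b * (M.P₀.prob (A ∩ Bᶜ) - M.P₀.prob Bᶜ * M.lower A) := by
    have hd : M.lower (A ∩ B) + (1 - M.lower (A ∪ Bᶜ)) = 1 - M.b * M.P₀.prob Bᶜ := by
      linear_combination e1 - e3 + M.b * (p1 - p2)
    rw [hd]
    linear_combination e2 - e1 - M.b * p1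
  constructor
  · intro h
    refine Or.inl ⟨h0, by linarith, ?_⟩
    have := nonneg_of_mul_nonneg_right (key ▸ sub_nonneg.2 h) M.b_pos
    linarith
  · rintro (⟨-, -, h⟩ | h)
    · have := mul_nonneg M.b_pos.le (sub_nonneg.2 h)
      linarith
    · exact absurd h h0.ne'

theorem dilatesAt_iff (hM : Coherent M.lower) {A B : Set Ω} : M.DilatesAt A B ↔
    lowerNatExt M.lower A B ≤ M.lower A ∧ lowerNatExt M.lower Aᶜ B ≤ M.lower Aᶜ := by
  rw [DilatesAt, upperNatExt, M.lower_compl]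
  constructor
  · rintro ⟨h1, -, h2⟩
    exact ⟨h1, by linarith⟩
  · rintro ⟨h1, h2⟩
    exact ⟨h1, M.lower_le_upper hM A, by linarith⟩

theorem dilatesAt_iff_conditions (hM : Coherent M.lower) {A B : Set Ω}
    (hA : ¬ M.Extreme A) (hB : 0 < M.lower B) :
    M.DilatesAt A B ↔ M.ConditionA A B ∧ M.ConditionB A B := by
  rw [dilatesAt_iff hM, conditionB_iff, lowerNatExt_le_iff hM hA hB,
    lowerNatExt_le_iff hM (fun h => hA h.of_compl) hB]

end NLModel

end NearlyLinear

theorem proposition5 {Ω : Type*} (M : NearlyLinear.NLModel Ω)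
    (hM : NearlyLinear.Coherent M.lower)
    (𝔅 : Set (Set Ω)) (h𝔅 : Setoid.IsPartition 𝔅)
    (A : Set Ω) (hext : ¬ M.Extreme A) (hind : NearlyLinear.LogicallyIndependent A 𝔅) :
    (∀ B ∈ 𝔅, 0 < M.lower B →
      (M.DilatesAt A B ↔ M.ConditionA A B ∧ M.ConditionB A B)) ∧
    (M.WeaklyDilates 𝔅 A ↔
      ∀ B ∈ 𝔅, 0 < M.lower B → M.ConditionA A B ∧ M.ConditionB A B) := by
  have hpos : ∀ B ∈ 𝔅, 0 < M.lower B →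
      (M.DilatesAt A B ↔ M.ConditionA A B ∧ M.ConditionB A B) := fun _ _ h =>
    NearlyLinear.NLModel.dilatesAt_iff_conditions hM hext h
  refine ⟨hpos, fun h B hB h0 => (hpos B hB h0).1 (h B hB), fun h B hB => ?_⟩
  rcases (M.lower_nonneg B).eq_or_lt with h0 | h0
  · have h2 := NearlyLinear.NLModel.isTwoMonotone_of_coherent hM
    exact (NearlyLinear.NLModel.dilatesAt_iff hM).2
      ⟨(h2.lowerNatExt_le_zero h0.symm (hind B hB).1).trans (M.lower_nonneg _),
        (h2.lowerNatExt_le_zero h0.symm (hind B hB).2).trans (M.lower_nonneg _)⟩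
  · exact (hpos B hB h0).2 (h B hB h0)
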